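/- A 3D drawing of a finite simple graph places its vertices at distinct points of $\mathbb{Z}^3$ so that, when each edge is drawn as the straight line segment between its endpoints, distinct edges intersect only at common endpoints and each edge contains no vertex other than its endpoints. If the minimum axis-aligned box containing the drawing has side lengths $X-1$, $Y-1$ and $Z-1$, then it is an $X\times Y\times Z$ drawing and its volume is $XYZ$. The degeneracy of a graph is the minimum integer $d$ such that every nonempty subgraph has a vertex of degree at most $d$ in that subgraph. Theorem. (a) There is an absolute constant $C$ such that every graph with $n$ vertices, $m\geq 1$ edges and degeneracy $d$ has an $X\times Y\times Z$ drawing with $X\leq C\sqrt{dm}$, $Y\leq C\sqrt{dm}$, $Z\leq Cn$ and volume $XYZ\leq C\,dnm$; that is, an $O(\sqrt{dm})\times O(\sqrt{dm})\times O(n)$ drawing with $O(dnm)$ volume. (b) For every integer $b\geq 0$ there is a constant $C_b$, depending only on $b$, such that every graph with $n\geq 1$ vertices and degeneracy at most $b$ has an $X\times Y\times Z$ drawing with $X\leq C_b$, $Y\leq C_b\sqrt{n}$, $Z\leq C_b n$ and volume $XYZ\leq C_b n^{3/2}$; that is, for bounded degeneracy there is an $O(1)\times O(\sqrt{n})\times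 O(n)$ drawing with $O(n^{3/2})$ volume. -/

import Mathlib

universe u

namespace SimpleGraph

variable {V : Type u}

/-- `G` is `d`-degenerate if every (nonempty) subgraph of `G` has a vertex whose degree in the
subgraph is at most `d`. -/
def IsDegenerate (G : SimpleGraph V) (d : ℕ) : Prop :=
  ∀ H : G.Subgraph, H.verts.Nonempty → ∃ v ∈ H.verts, (H.neighborSet v).ncard ≤ d

/-- The degeneracy of a (finite) graph: the minimum `d` such that `G` is `d`-degenerate. -/
noncomputable def degeneracy (G : SimpleGraph V) : ℕ :=
  sInf {d : ℕ | G.IsDegenerate d}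

/-- For a finite graph the set defining the degeneracy is nonempty, so the minimum is attained. -/
theorem isDegenerate_degeneracy [Finite V] (G : SimpleGraph V) : G.IsDegenerate G.degeneracy := by
  have hne : {d : ℕ | G.IsDegenerate d}.Nonempty := by
    refine ⟨Nat.card V, ?_⟩
    rintro H ⟨v, hv⟩
    exact ⟨v, hv, Set.ncard_le_card _⟩
  exact Nat.sInf_mem hne

/-- The point of `ℝ³` with the given integer coordinates. -/
def gridPoint (a : Fin 3 → ℤ) : Fin 3 → ℝ := fun i => (a i : ℝ)

/-- A three-dimensional straight line grid drawing of `G`: the vertices are placed at distinct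
points of `ℤ³` and the edges are drawn as straight line segments, such that each edge meets a
vertex only if that vertex is one of its endpoints, and distinct edges intersect only at common
endpoints. -/
structure GridDrawing (G : SimpleGraph V) where
  /-- The three coordinates of each vertex. -/
  pos : V → Fin 3 → ℤ
  pos_injective : Function.Injective pos
  vertex_on_edge : ∀ ⦃v w : V⦄, G.Adj v w → ∀ u : V,
    gridPoint (pos u) ∈ segment ℝ (gridPoint (pos v)) (gridPoint (pos w)) → u = v ∨ u = w
  edge_inter_edge : ∀ ⦃v w x y : V⦄, G.Adj v w → G.Adj x y → s(v, w) ≠ s(x, y) →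
    ∀ p : Fin 3 → ℝ, p ∈ segment ℝ (gridPoint (pos v)) (gridPoint (pos w)) →
      p ∈ segment ℝ (gridPoint (pos x)) (gridPoint (pos y)) →
      ∃ u : V, u ∈ s(v, w) ∧ u ∈ s(x, y) ∧ p = gridPoint (pos u)

namespace GridDrawing

variable [Fintype V] [Nonempty V] {G : SimpleGraph V}

/-- The size of the bounding box of a drawing in the `i`-th coordinate direction, counted in
gridpoints: the side length of the box plus one. -/
def size (D : G.GridDrawing) (i : Fin 3) : ℕ :=
  (Finset.univ.sup' Finset.univ_nonempty (fun v => D.pos v i)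
    - Finset.univ.inf' Finset.univ_nonempty (fun v => D.pos v i)).toNat + 1

/-- The width `X` of an `X × Y × Z` drawing. -/
def width (D : G.GridDrawing) : ℕ := D.size 0

/-- The depth `Y` of an `X × Y × Z` drawing. -/
def depth (D : G.GridDrawing) : ℕ := D.size 1

/-- The height `Z` of an `X × Y × Z` drawing. -/
def height (D : G.GridDrawing) : ℕ := D.size 2

/-- The volume `X · Y · Z` of an `X × Y × Z` drawing. -/
def volume (D : G.GridDrawing) : ℕ := D.width * D.depth * D.height

end GridDrawing

end SimpleGraph

/-! Put vertices near the moment curve `(i, i², i³)` modulo a prime `p`. A vanishing determinant for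
four vertices in distinct planes `x = i` would vanish modulo `p`, yet there it is a Vandermonde
determinant and a unit. So only edges with endpoints in a common plane can cross
(`GridDrawing.ofGeneralPosition`, `GridDrawing.ofMomentCurve`).

For (a), use a proper colouring in which the edges between any two colour classes form a star. Each
class is stacked on one vertical line, in steps of `p`; two edges leaving the same line then either
share a vertex or project to non-collinear directions. The number of colours is `O(√(dm))` by a
greedy argument along a degeneracy order (`IsDegenerate.exists_strongStar`). With `s ≈ √(dm)`, the
`O(s)` vertices of degree above about `s/d` get private colours; classes of the others keep total
degree at most `s/d`, so each new vertex sees about `d · s/d` conflicts.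

For (b), a proper `(b+1)`-colouring selects the plane, and the star colouring, now with `O(√n)`
colours, selects a vertical track inside it. Many tracks share a plane, so crossings of edges
leaving different tracks of one plane must also be excluded. The heights follow the saddle `z =
Lxy`, whose twist separates such edges once `L` dominates the stacking heights
(`le_of_meet_of_two_planes`, `le_of_meet_of_three_planes`). -/

namespace SimpleGraph

/-! ### Degeneracy: vertex orders, proper colourings and edge counts. -/

variable {V : Type u} {G : SimpleGraph V} {d : ℕ}

open Classical in
/-- Induction along a degeneracy order: vertices are added one at a time, each with at most `d`
neighbours among those already present. -/
theorem IsDegenerate.induction (hG : G.IsDegenerate d) {P : Finset V → Prop} (empty : P ∅)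
    (insert : ∀ (S : Finset V) (v : V), v ∉ S → (S.filter (G.Adj v)).card ≤ d → P S →
      P (insert v S)) (S : Finset V) : P S := by
  induction S using Finset.strongInduction with
  | H S ih =>
    rcases S.eq_empty_or_nonempty with rfl | hS
    · exact empty
    -- The last vertex to be inserted is one of low degree in the subgraph induced on `S`.
    obtain ⟨v, hv, hd⟩ := hG ((⊤ : G.Subgraph).induce (S : Set V)) (by simpa using hS)
    replace hv : v ∈ S := by simpa using hv
    rw [← Finset.insert_erase hv]
    refine insert _ v (Finset.notMem_erase v S) (le_trans ?_ hd)
      (ih _ (Finset.erase_ssubset hv))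
    rw [← Set.ncard_coe_finset]
    refine Set.ncard_le_ncard ?_ (S.finite_toSet.subset ?_)
    · intro w hw
      simp only [Finset.coe_filter, Finset.mem_erase, Set.mem_ofPred_eq] at hw
      simp [hv, hw.1.2, hw.2]
    · intro w hw
      simp only [Subgraph.mem_neighborSet, Subgraph.induce_adj] at hw
      exact hw.2.1

theorem IsDegenerate.mono {e : ℕ} (hG : G.IsDegenerate d) (h : d ≤ e) : G.IsDegenerate e := by
  intro H hH
  obtain ⟨v, hv, hd⟩ := hG H hH
  exact ⟨v, hv, hd.trans h⟩

/-- A `d`-degenerate graph has a proper colouring with `d + 1` colours. -/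
theorem IsDegenerate.exists_coloring [Finite V] (hG : G.IsDegenerate d) :
    ∃ f : V → Fin (d + 1), ∀ v w, G.Adj v w → f v ≠ f w := by
  classical
  have := Fintype.ofFinite V
  have key : ∀ S : Finset V, ∃ f : V → Fin (d + 1), ∀ v ∈ S, ∀ w ∈ S, G.Adj v w → f v ≠ f w := by
    intro S
    refine hG.induction (P := fun S => ∃ f : V → Fin (d + 1),
      ∀ v ∈ S, ∀ w ∈ S, G.Adj v w → f v ≠ f w) ⟨fun _ => 0, by simp⟩ ?_ S
    rintro S v hv hd ⟨f, hf⟩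
    obtain ⟨c, hc⟩ : ∃ c, c ∉ (S.filter (G.Adj v)).image f := by
      by_contra! h
      have h1 : ((S.filter (G.Adj v)).image f) = Finset.univ := by ext; simp [h]
      have h2 := (Finset.card_image_le (s := S.filter (G.Adj v)) (f := f)).trans hd
      rw [h1, Finset.card_univ, Fintype.card_fin] at h2
      omega
    have hc' : ∀ w ∈ S, G.Adj v w → f w ≠ c := fun w hw hvw hcw =>
      hc (Finset.mem_image.2 ⟨w, by simp [hw, hvw], hcw⟩)
    have hne : ∀ w ∈ S, w ≠ v := fun w hw h => hv (h ▸ hw)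
    refine ⟨Function.update f v c, ?_⟩
    intro x hx y hy hxy
    rcases Finset.mem_insert.1 hx with rfl | hxS <;> rcases Finset.mem_insert.1 hy with rfl | hyS
    · exact (hxy.ne rfl).elim
    · simpa [Function.update_of_ne (hne y hyS)] using (hc' y hyS hxy).symm
    · simpa [Function.update_of_ne (hne x hxS)] using hc' x hxS hxy.symm
    · simpa [Function.update_of_ne (hne y hyS), Function.update_of_ne (hne x hxS)] using
        hf x hxS y hyS hxy
  obtain ⟨f, hf⟩ := key Finset.univ
  exact ⟨f, fun v w => hf v (Finset.mem_univ v) w (Finset.mem_univ w)⟩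

open Classical in
theorem sum_degree_eq_two_mul_ncard_edgeSet [Fintype V] (G : SimpleGraph V) :
    ∑ v, G.degree v = 2 * G.edgeSet.ncard := by
  rw [G.sum_degrees_eq_twice_card_edges, Set.ncard_eq_toFinset_card', edgeFinset]

/-- A `d`-degenerate graph with `n` vertices has at most `d * n` edges. -/
theorem IsDegenerate.ncard_edgeSet_le [Fintype V] (hG : G.IsDegenerate d) :
    G.edgeSet.ncard ≤ d * Fintype.card V := by
  classical
  -- An inserted vertex raises the degree sum inside `S` by twice its number of earlier neighbours.
  have key : ∀ S : Finset V, ∑ v ∈ S, (S.filter (G.Adj v)).card ≤ 2 * (d * S.card) := by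
    intro S
    refine hG.induction
      (P := fun S => ∑ v ∈ S, (S.filter (G.Adj v)).card ≤ 2 * (d * S.card)) (by simp) ?_ S
    intro S v hv hd ih
    have h1 : ∀ w ∈ S, ((insert v S).filter (G.Adj w)).card =
        (S.filter (G.Adj w)).card + if G.Adj v w then 1 else 0 := by
      intro w _
      rw [Finset.filter_insert, G.adj_comm w v]
      split_ifs
      · rw [Finset.card_insert_of_notMem (by simp [hv])]
      · simp
    rw [Finset.sum_insert hv, Finset.sum_congr rfl h1, Finset.sum_add_distrib,
      Finset.filter_insert, if_neg (G.loopless.irrefl v), ← Finset.card_filter,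
      Finset.card_insert_of_notMem hv]
    linarith
  have h := key Finset.univ
  have h2 := sum_degree_eq_two_mul_ncard_edgeSet G
  have h3 : ∀ v, (Finset.univ.filter (G.Adj v)).card = G.degree v := by
    intro v
    rw [← card_neighborFinset_eq_degree, neighborFinset_eq_filter]
  simp only [h3, Finset.card_univ] at h
  have : (∑ v, G.degree v) = 2 * G.edgeSet.ncard := by convert h2
  omega

/-- Edges at one vertex inject into all edges. With `d ≤ m`, the parameter `s > √(dm)` is at least
`d`, as the star colouring requires. -/
theorem degeneracy_le_ncard_edgeSet [Finite V] (G : SimpleGraph V) :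
    G.degeneracy ≤ G.edgeSet.ncard := by
  refine Nat.sInf_le ?_
  rintro H ⟨v, hv⟩
  refine ⟨v, hv, Set.ncard_le_ncard_of_injOn (fun w => s(v, w)) ?_ ?_ (Set.toFinite _)⟩
  · intro w hw
    exact H.adj_sub hw
  · intro w _ w' _ h
    exact Sym2.congr_right.1 h

theorem one_le_degeneracy [Finite V] (hm : 1 ≤ G.edgeSet.ncard) : 1 ≤ G.degeneracy := by
  by_contra! h
  obtain ⟨e, he⟩ := (Set.ncard_pos (Set.toFinite _)).1 hm
  induction e using Sym2.ind with
  | _ a b =>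
    have hab : G.Adj a b := he
    obtain ⟨v, hv, hd⟩ := G.isDegenerate_degeneracy (G.subgraphOfAdj hab) ⟨a, by simp⟩
    have h0 : ((G.subgraphOfAdj hab).neighborSet v) = ∅ := by
      rw [← Set.ncard_eq_zero (Set.toFinite _)]
      omega
    have h1 : ∀ w, w ∉ (G.subgraphOfAdj hab).neighborSet v := by simp [h0]
    rcases (show v = a ∨ v = b by simpa using hv) with rfl | rfl
    · exact h1 b (by simp)
    · exact h1 a (by simp)

end SimpleGraph

/-! ### Balanced colourings with a star between any two classes. -/

namespace SimpleGraph

variable {V : Type u} {G : SimpleGraph V} {d : ℕ}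

open Classical in
/-- Greedy colouring of low-degree vertices of a degenerate graph such that any two edges between
the same pair of colour classes share a vertex, while the total degree and the size of every
colour class stay bounded. -/
theorem IsDegenerate.exists_strongStar_of_degree_le [Fintype V] (hG : G.IsDegenerate d)
    {a k B l : ℕ} (ha : 2 * ∑ v, G.degree v < a * (B + 1)) (hk : Fintype.card V < k * l)
    (S : Finset V) (hS : ∀ v ∈ S, 2 * G.degree v ≤ B) :
    ∃ f : V → Fin (a + k + d * (B + 1)),
      (∀ v ∈ S, ∀ w ∈ S, G.Adj v w → f v ≠ f w) ∧
      (∀ v ∈ S, ∀ w ∈ S, ∀ x ∈ S, ∀ y ∈ S, G.Adj v w → G.Adj x y → f v = f x → f w = f y →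
        v = x ∨ w = y) ∧
      (∀ c, ∑ v ∈ S with f v = c, G.degree v ≤ B) ∧ ∀ c, (S.filter fun v => f v = c).card ≤ l := by
  revert hS
  refine hG.induction (P := fun S => (∀ v ∈ S, 2 * G.degree v ≤ B) →
    ∃ f : V → Fin (a + k + d * (B + 1)),
      (∀ v ∈ S, ∀ w ∈ S, G.Adj v w → f v ≠ f w) ∧
      (∀ v ∈ S, ∀ w ∈ S, ∀ x ∈ S, ∀ y ∈ S, G.Adj v w → G.Adj x y → f v = f x → f w = f y →
        v = x ∨ w = y) ∧
      (∀ c, ∑ v ∈ S with f v = c, G.degree v ≤ B) ∧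
      ∀ c, (S.filter fun v => f v = c).card ≤ l) ?_ ?_ S
  · intro _
    have ha0 : 0 < a := by
      rcases Nat.eq_zero_or_pos a with rfl | h
      · simp at ha
      · exact h
    exact ⟨fun _ => ⟨0, by omega⟩, by simp⟩
  intro S v hv hd ih hS
  obtain ⟨f, hproper, hstar, hweight, hsize⟩ := ih fun w hw => hS w (Finset.mem_insert_of_mem hw)
  set U := S.filter (G.Adj v) with hU
  -- The forbidden colours for `v` are of three kinds, matching the three summands of the palette.
  -- Since `v` has degree at most `B / 2`, a `heavy` class already has total degree above `B / 2`,
  -- so fewer than `a` are heavy.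
  set heavy := Finset.univ.filter fun c => B < (∑ w ∈ S with f w = c, G.degree w) + G.degree v
    with hheavy
  set full := Finset.univ.filter fun c => l ≤ (S.filter fun w => f w = c).card with hfull
  set conflict := U.biUnion fun u => insert (f u)
    ((S.filter fun y => f y = f u).biUnion fun y => (G.neighborFinset y).image f) with hconflict
  have hheavy_card : heavy.card < a := by
    by_contra! h
    have h1 : heavy.card * (B + 1) ≤ ∑ c ∈ heavy, 2 * ∑ w ∈ S with f w = c, G.degree w := by
      rw [← smul_eq_mul]
      refine Finset.card_nsmul_le_sum _ _ _ fun c hc => ?_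
      have h2 := (Finset.mem_filter.1 hc).2
      have h3 := hS v (Finset.mem_insert_self _ _)
      omega
    have h2 : ∑ c ∈ heavy, 2 * ∑ w ∈ S with f w = c, G.degree w ≤
        2 * ∑ c, ∑ w ∈ S with f w = c, G.degree w := by
      rw [Finset.mul_sum]
      exact Finset.sum_le_sum_of_subset (Finset.subset_univ _)
    rw [Finset.sum_fiberwise] at h2
    have h3 : ∑ w ∈ S, G.degree w ≤ ∑ w, G.degree w :=
      Finset.sum_le_sum_of_subset (Finset.subset_univ _)
    have h4 := Nat.mul_le_mul_right (B + 1) h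
    omega
  have hfull_card : full.card < k := by
    by_contra! h
    have h1 : full.card * l ≤ ∑ c ∈ full, (S.filter fun w => f w = c).card := by
      rw [← smul_eq_mul]
      exact Finset.card_nsmul_le_sum _ _ _ fun c hc => (Finset.mem_filter.1 hc).2
    have h2 : ∑ c ∈ full, (S.filter fun w => f w = c).card ≤
        ∑ c, (S.filter fun w => f w = c).card :=
      Finset.sum_le_sum_of_subset (Finset.subset_univ _)
    rw [← Finset.card_eq_sum_card_fiberwise (fun _ _ => Finset.mem_coe.2 (Finset.mem_univ _))] at h2
    have h3 := Finset.card_le_univ S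
    have h4 := Nat.mul_le_mul_right l h
    omega
  -- For each of the at most `d` earlier neighbours `u`, the class of `u` has at most `B` neighbours
  -- by the degree invariant; the colour of `u` itself is the `+ 1`.
  have hconflict_card : conflict.card ≤ d * (B + 1) := by
    refine (Finset.card_biUnion_le_card_mul _ _ (B + 1) fun u _ => ?_).trans
      (Nat.mul_le_mul_right _ hd)
    refine (Finset.card_insert_le _ _).trans (Nat.succ_le_succ ?_)
    refine Finset.card_biUnion_le.trans (le_trans (Finset.sum_le_sum fun y _ => ?_) (hweight (f u)))
    exact Finset.card_image_le
  obtain ⟨c, hc⟩ : ∃ c, c ∉ heavy ∪ full ∪ conflict := by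
    by_contra! h
    have h1 : heavy ∪ full ∪ conflict = Finset.univ := by ext; simp only [h, Finset.mem_univ]
    have h2 := Finset.card_union_le (heavy ∪ full) conflict
    have h3 := Finset.card_union_le heavy full
    rw [h1, Finset.card_univ, Fintype.card_fin] at h2
    omega
  simp only [Finset.mem_union, not_or] at hc
  obtain ⟨⟨hc1, hc2⟩, hc3⟩ := hc
  have hc1' : (∑ w ∈ S with f w = c, G.degree w) + G.degree v ≤ B := by
    simpa [hheavy] using hc1
  have hc2' : (S.filter fun w => f w = c).card < l := by
    simpa [hfull] using hc2
  have hcne : ∀ u ∈ S, G.Adj v u → f u ≠ c := by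
    rintro u hu hvu rfl
    exact hc3 (Finset.mem_biUnion.2 ⟨u, by simp [hU, hu, hvu], Finset.mem_insert_self _ _⟩)
  have hcstar : ∀ u ∈ S, G.Adj v u → ∀ x y, y ∈ S → f y = f u → G.Adj x y → f x ≠ c := by
    rintro u hu hvu x y hy hyu hxy rfl
    refine hc3 (Finset.mem_biUnion.2 ⟨u, by simp [hU, hu, hvu], Finset.mem_insert_of_mem ?_⟩)
    refine Finset.mem_biUnion.2 ⟨y, by simp [hy, hyu], Finset.mem_image_of_mem f ?_⟩
    simpa using hxy.symm
  have hne : ∀ w ∈ S, w ≠ v := fun w hw h => hv (h ▸ hw)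
  have hfS : ∀ w ∈ S, Function.update f v c w = f w := fun w hw =>
    Function.update_of_ne (hne w hw) _ _
  have hfv : Function.update f v c v = c := Function.update_self ..
  have hfilter : ∀ c', S.filter (fun w => Function.update f v c w = c') =
      S.filter fun w => f w = c' := fun c' => Finset.filter_congr fun w hw => by rw [hfS w hw]
  have hproper' : ∀ w ∈ insert v S, ∀ x ∈ insert v S, G.Adj w x →
      Function.update f v c w ≠ Function.update f v c x := by
    intro x hx y hy hxy
    rcases Finset.mem_insert.1 hx with rfl | hxS <;> rcases Finset.mem_insert.1 hy with rfl | hyS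
    · exact (hxy.ne rfl).elim
    · rw [hfv, hfS y hyS]
      exact (hcne y hyS hxy).symm
    · rw [hfv, hfS x hxS]
      exact hcne x hxS hxy.symm
    · rw [hfS x hxS, hfS y hyS]
      exact hproper x hxS y hyS hxy
  -- The star condition is symmetric under swapping the edges and reversing both, so every position
  -- of the new vertex reduces to this one.
  have hnew : ∀ w ∈ insert v S, ∀ x ∈ insert v S, ∀ y ∈ insert v S, G.Adj v w → G.Adj x y →
      c = Function.update f v c x → Function.update f v c w = Function.update f v c y →
      v = x := by
    intro w hw x hx y hy hvw hxy hcx hwy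
    by_contra hvx
    have hwS : w ∈ S := (Finset.mem_insert.1 hw).resolve_left hvw.ne'
    have hxS : x ∈ S := (Finset.mem_insert.1 hx).resolve_left (Ne.symm hvx)
    rw [hfS x hxS] at hcx
    rcases Finset.mem_insert.1 hy with rfl | hyS
    · rw [hfS w hwS, hfv] at hwy
      exact hcne w hwS hvw hwy
    · rw [hfS w hwS, hfS y hyS] at hwy
      exact hcstar w hwS hvw x y hyS hwy.symm hxy hcx.symm
  refine ⟨Function.update f v c, hproper', ?_, ?_, ?_⟩
  · intro w hw x hx y hy z hz hwx hyz hfwy hfxz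
    by_cases hwv : w = v
    · subst hwv
      exact Or.inl (hnew x hx y hy z hz hwx hyz (hfv.symm.trans hfwy) hfxz)
    by_cases hxv : x = v
    · subst hxv
      exact Or.inr (hnew w hw z hz y hy hwx.symm hyz.symm (hfv.symm.trans hfxz) hfwy)
    by_cases hyv : y = v
    · subst hyv
      exact Or.inl (hnew z hz w hw x hx hyz hwx (hfv.symm.trans hfwy.symm) hfxz.symm).symm
    by_cases hzv : z = v
    · subst hzv
      exact Or.inr (hnew y hy x hx w hw hyz.symm hwx.symm (hfv.symm.trans hfxz.symm)
        hfwy.symm).symm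
    have hw := (Finset.mem_insert.1 hw).resolve_left hwv
    have hx := (Finset.mem_insert.1 hx).resolve_left hxv
    have hy := (Finset.mem_insert.1 hy).resolve_left hyv
    have hz := (Finset.mem_insert.1 hz).resolve_left hzv
    rw [hfS w hw, hfS y hy] at hfwy
    rw [hfS x hx, hfS z hz] at hfxz
    exact hstar w hw x hx y hy z hz hwx hyz hfwy hfxz
  · intro c'
    rw [Finset.filter_insert, hfv, hfilter]
    split_ifs with h
    · subst h
      rw [Finset.sum_insert (by simp [hv])]
      omega
    · exact hweight c'
  · intro c'
    rw [Finset.filter_insert, hfv, hfilter]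
    split_ifs with h
    · subst h
      rw [Finset.card_insert_of_notMem (by simp [hv])]
      omega
    · exact hsize c'

/-- A `d`-degenerate graph with `m` edges, where `d * m < s ^ 2`, has a proper colouring with
`11 * s` colours and balanced colour classes, such that any two edges between the same pair of
colour classes share a vertex. -/
theorem IsDegenerate.exists_strongStar [Fintype V] (hG : G.IsDegenerate d) {s : ℕ} (hd : 1 ≤ d)
    (hds : d ≤ s) (hm : d * G.edgeSet.ncard < s * s) :
    ∃ f : V → ℕ, (∀ v, f v < 11 * s) ∧ (∀ v w, G.Adj v w → f v ≠ f w) ∧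
      (∀ v w x y, G.Adj v w → G.Adj x y → f v = f x → f w = f y → v = x ∨ w = y) ∧
      ∀ c, {v | f v = c}.ncard ≤ Fintype.card V / s + 1 := by
  classical
  -- This choice balances the two costs: `d * (B + 1) ≤ 2 * s` conflicts, and fewer than `4 * s`
  -- vertices of degree above `B / 2`, because `m < s * (B + 1)`.
  set B := s / d with hB
  have hs : 0 < s := by omega
  have hB1 : d * B ≤ s := Nat.mul_div_le s d
  have hB2 : s < d * (B + 1) := Nat.lt_mul_div_succ s hd
  have hsum : 2 * ∑ v, G.degree v < 4 * s * (B + 1) := by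
    have h1 : ∑ v, G.degree v = 2 * G.edgeSet.ncard := by
      convert sum_degree_eq_two_mul_ncard_edgeSet G
    rw [h1]
    by_contra! h
    have h2 : s * (B + 1) ≤ G.edgeSet.ncard := by linarith
    have h3 := Nat.mul_le_mul_left d h2
    have h4 := Nat.mul_le_mul_left s hB2.le
    linarith
  have hcard : Fintype.card V < s * (Fintype.card V / s + 1) := Nat.lt_mul_div_succ _ hs
  set low := Finset.univ.filter fun v => 2 * G.degree v ≤ B with hlow
  obtain ⟨f, hproper, hstar, -, hsize⟩ := hG.exists_strongStar_of_degree_le (a := 4 * s)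
    (k := s) (B := B) (l := Fintype.card V / s + 1)
    (by convert hsum) hcard low (by intro v hv; convert (Finset.mem_filter.1 hv).2)
  have hK : 4 * s + s + d * (B + 1) ≤ 7 * s := by linarith
  set high := Finset.univ.filter fun v => ¬ 2 * G.degree v ≤ B with hhigh
  have hhigh_card : high.card < 4 * s := by
    by_contra! h
    have h1 : high.card * (B + 1) ≤ ∑ v ∈ high, 2 * G.degree v := by
      rw [← smul_eq_mul]
      refine Finset.card_nsmul_le_sum _ _ _ fun v hv => ?_
      have := (Finset.mem_filter.1 hv).2
      omega
    have h2 : ∑ v ∈ high, 2 * G.degree v ≤ 2 * ∑ v, G.degree v := by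
      rw [Finset.mul_sum]
      exact Finset.sum_le_sum_of_subset (Finset.subset_univ _)
    have h4 := Nat.mul_le_mul_right (B + 1) h
    omega
  have hmem : ∀ v, v ∈ low ∨ v ∈ high := fun v => by
    simp only [hlow, hhigh, Finset.mem_filter_univ]
    exact em _
  -- Low-degree vertices use colours below `7 * s`; each high-degree vertex gets a private colour
  -- from the next `4 * s`.
  let g : V → ℕ := fun v => if h : v ∈ high then 7 * s + high.equivFin ⟨v, h⟩ else f v
  have hg_high : ∀ v w, v ∈ high → g v = g w → v = w := by
    intro v w hv hvw
    by_cases hw : w ∈ high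
    · simp only [g, hv, hw, dif_pos, Nat.add_left_cancel_iff] at hvw
      simpa using high.equivFin.injective (Fin.ext hvw)
    · simp only [g, hv, hw, dif_pos, dif_neg, not_false_eq_true] at hvw
      have := (f w).2
      omega
  have hg_low : ∀ v, v ∉ high → g v = f v := fun v hv => dif_neg hv
  have hlow_of : ∀ v, v ∉ high → v ∈ low := fun v hv => (hmem v).resolve_right hv
  refine ⟨g, ?_, ?_, ?_, ?_⟩
  · intro v
    by_cases hv : v ∈ high
    · have := (high.equivFin ⟨v, hv⟩).2
      simp only [g, hv, dif_pos]
      omega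
    · have := (f v).2
      rw [hg_low v hv]
      omega
  · intro v w hvw h
    by_cases hv : v ∈ high
    · exact hvw.ne (hg_high v w hv h)
    by_cases hw : w ∈ high
    · exact hvw.ne' (hg_high w v hw h.symm)
    rw [hg_low v hv, hg_low w hw] at h
    exact hproper v (hlow_of v hv) w (hlow_of w hw) hvw (Fin.ext h)
  · intro v w x y hvw hxy hvx hwy
    by_cases hv : v ∈ high
    · exact Or.inl (hg_high v x hv hvx)
    by_cases hw : w ∈ high
    · exact Or.inr (hg_high w y hw hwy)
    by_cases hx : x ∈ high
    · exact Or.inl (hg_high x v hx hvx.symm).symm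
    by_cases hy : y ∈ high
    · exact Or.inr (hg_high y w hy hwy.symm).symm
    rw [hg_low v hv, hg_low x hx] at hvx
    rw [hg_low w hw, hg_low y hy] at hwy
    exact hstar v (hlow_of v hv) w (hlow_of w hw) x (hlow_of x hx) y (hlow_of y hy) hvw hxy
      (Fin.ext hvx) (Fin.ext hwy)
  · intro c
    by_cases hc : ∃ v ∈ high, g v = c
    · obtain ⟨v, hv, rfl⟩ := hc
      have : {w | g w = g v} = {v} := by
        ext w
        exact ⟨fun h => (hg_high v w hv (Eq.symm h)).symm, fun h => congrArg g h⟩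
      rw [this, Set.ncard_singleton]
      exact Nat.succ_pos _
    · by_cases hne : {v | g v = c} = ∅
      · simp [hne]
      obtain ⟨u, hu⟩ := Set.nonempty_iff_ne_empty.2 hne
      have hu' : u ∉ high := fun h => hc ⟨u, h, hu⟩
      refine le_trans ?_ (hsize (f u))
      rw [← Set.ncard_coe_finset]
      refine Set.ncard_le_ncard ?_ (Finset.finite_toSet _)
      intro w hw
      have hw' : w ∉ high := fun h => hc ⟨w, h, hw⟩
      have h : g w = g u := Eq.trans hw (Eq.symm hu)
      rw [hg_low w hw', hg_low u hu'] at h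
      simpa [Fin.ext h] using hlow_of w hw'

/-- If the fibres of `f` have at most `l` elements, then the elements can be given heights below
`l` that distinguish the elements of each fibre. -/
theorem exists_height_of_ncard_fiber_le [Finite V] {ι : Type*} (f : V → ι) {l : ℕ}
    (hf : ∀ c, {v | f v = c}.ncard ≤ l) :
    ∃ h : V → ℕ, (∀ v, h v < l) ∧ ∀ v w, f v = f w → h v = h w → v = w := by
  classical
  have := Fintype.ofFinite V
  have hcard : ∀ c, Fintype.card {v // f v = c} ≤ l := fun c => by
    rw [← Nat.card_eq_fintype_card]
    exact hf c
  refine ⟨fun v => Fintype.equivFin {w // f w = f v} ⟨v, rfl⟩, fun v => ?_, fun v w hvw h => ?_⟩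
  · exact (Fin.is_lt _).trans_le (hcard _)
  · have key : ∀ c (hv : f v = c) (hw : f w = c), (Fintype.equivFin {u // f u = c} ⟨v, hv⟩ : ℕ) =
        Fintype.equivFin {u // f u = c} ⟨w, hw⟩ → v = w := by
      intro c hv hw h
      simpa using (Fintype.equivFin _).injective (Fin.ext h)
    -- The numberings for `v` and `w` live on fibres over `f v` and `f w`, and are compared by
    -- transport.
    have hcast : ∀ c c' (hc : c = c') (hv : f v = c),
        (Fintype.equivFin {u // f u = c'} ⟨v, hv.trans hc⟩ : ℕ) =
          Fintype.equivFin {u // f u = c} ⟨v, hv⟩ := by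
      rintro c _ rfl hv
      rfl
    exact key (f w) hvw rfl ((hcast _ _ hvw rfl).trans h)

end SimpleGraph

/-! ### A general position criterion for grid drawings. -/

namespace SimpleGraph

variable {V : Type u} {G : SimpleGraph V}

theorem exists_of_mem_segment_gridPoint {a b : Fin 3 → ℤ} {q : Fin 3 → ℝ}
    (h : q ∈ segment ℝ (gridPoint a) (gridPoint b)) :
    ∃ t : ℝ, 0 ≤ t ∧ t ≤ 1 ∧ ∀ i, q i = a i + t * (b i - a i) := by
  rw [segment_eq_image'] at h
  obtain ⟨t, ⟨h0, h1⟩, rfl⟩ := h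
  exact ⟨t, h0, h1, fun i => by simp [gridPoint]⟩

/-- A criterion for grid drawings in which every plane orthogonal to the first axis holds an
independent set. The vertices in different such planes are in general position, so that only
pairs of edges with endpoints in a common plane have to be considered. -/
def GridDrawing.ofGeneralPosition (pos : V → Fin 3 → ℤ) (inj : Function.Injective pos)
    (hadj : ∀ v w, G.Adj v w → pos v 0 ≠ pos w 0)
    (hline : ∀ a b c, pos a 0 ≠ pos b 0 → pos a 0 ≠ pos c 0 → pos b 0 ≠ pos c 0 →
      (pos b 0 - pos a 0) * (pos c 1 - pos a 1) - (pos c 0 - pos a 0) * (pos b 1 - pos a 1) ≠ 0)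
    (hplane : ∀ a b c e, pos a 0 ≠ pos b 0 → pos a 0 ≠ pos c 0 → pos a 0 ≠ pos e 0 →
      pos b 0 ≠ pos c 0 → pos b 0 ≠ pos e 0 → pos c 0 ≠ pos e 0 →
      (pos b 0 - pos a 0) * ((pos c 1 - pos a 1) * (pos e 2 - pos a 2) -
          (pos c 2 - pos a 2) * (pos e 1 - pos a 1)) -
        (pos b 1 - pos a 1) * ((pos c 0 - pos a 0) * (pos e 2 - pos a 2) -
          (pos c 2 - pos a 2) * (pos e 0 - pos a 0)) +
        (pos b 2 - pos a 2) * ((pos c 0 - pos a 0) * (pos e 1 - pos a 1) -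
          (pos c 1 - pos a 1) * (pos e 0 - pos a 0)) ≠ 0)
    (hshared : ∀ v w x y, G.Adj v w → G.Adj x y → pos v 0 = pos x 0 → v ≠ x → w ≠ y →
      ∀ s t : ℝ, 0 ≤ s → s ≤ 1 → 0 ≤ t → t ≤ 1 →
      ¬ ∀ i, (pos v i + s * (pos w i - pos v i) : ℝ) = pos x i + t * (pos y i - pos x i)) :
    G.GridDrawing where
  pos := pos
  pos_injective := inj
  vertex_on_edge := by
    intro v w hvw u hu
    obtain ⟨t, h0, h1, ht⟩ := exists_of_mem_segment_gridPoint hu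
    simp only [gridPoint] at ht
    by_contra! hne
    have hx : (pos v 0 : ℝ) ≠ pos w 0 := by exact_mod_cast hadj v w hvw
    by_cases huv : pos u 0 = pos v 0
    · have h2 := ht 0
      rw [huv] at h2
      have ht0 : t = 0 := by
        have : t * ((pos w 0 : ℝ) - pos v 0) = 0 := by linarith
        rcases mul_eq_zero.1 this with h | h
        · exact h
        · exact (hx (by linarith)).elim
      refine hne.1 (inj (funext fun i => ?_))
      have := ht i
      rw [ht0, zero_mul, add_zero] at this
      exact_mod_cast this
    by_cases huw : pos u 0 = pos w 0
    · have h2 := ht 0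
      rw [huw] at h2
      have ht0 : t = 1 := by
        have : (t - 1) * ((pos w 0 : ℝ) - pos v 0) = 0 := by linarith
        rcases mul_eq_zero.1 this with h | h
        · linarith
        · exact (hx (by linarith)).elim
      refine hne.2 (inj (funext fun i => ?_))
      have := ht i
      rw [ht0, one_mul, add_sub_cancel] at this
      exact_mod_cast this
    · refine hline v w u (hadj v w hvw) (fun h => huv h.symm) (fun h => huw h.symm) ?_
      have h2 : (((pos w 0 - pos v 0) * (pos u 1 - pos v 1) -
          (pos u 0 - pos v 0) * (pos w 1 - pos v 1) : ℤ) : ℝ) = 0 := by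
        push_cast
        rw [ht 0, ht 1]
        ring
      exact_mod_cast h2
  edge_inter_edge := by
    -- Two edges at `v` meet only at `v`: far ends in one plane force equal parameters, and far ends
    -- in different planes give independent directions by `hline`.
    have hstar : ∀ v w y, G.Adj v w → G.Adj v y → w ≠ y → ∀ s t : ℝ,
        (∀ i, (pos v i + s * (pos w i - pos v i) : ℝ) = pos v i + t * (pos y i - pos v i)) →
        s = 0 := by
      intro v w y hvw hvy hwy s t h
      have hx : (pos v 0 : ℝ) ≠ pos w 0 := by exact_mod_cast hadj v w hvw
      by_cases hxy : pos w 0 = pos y 0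
      · have h0 := h 0
        rw [← hxy] at h0
        have hst : s = t := by
          have : (s - t) * ((pos w 0 : ℝ) - pos v 0) = 0 := by linarith
          rcases mul_eq_zero.1 this with h | h
          · linarith
          · exact (hx (by linarith)).elim
        subst hst
        by_contra hs
        refine hwy (inj (funext fun i => ?_))
        have h2 : s * ((pos w i : ℝ) - pos y i) = 0 := by linarith [h i]
        rcases mul_eq_zero.1 h2 with h3 | h3
        · exact (hs h3).elim
        · exact_mod_cast (by linarith : (pos w i : ℝ) = pos y i)
      · have h1 := hline v w y (hadj v w hvw) (hadj v y hvy) hxy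
        have h2 : ((pos w 0 - pos v 0 : ℝ)) * (pos y 1 - pos v 1) -
          (pos y 0 - pos v 0) * (pos w 1 - pos v 1) ≠ 0 := by exact_mod_cast h1
        have h3 : s * (((pos w 0 - pos v 0 : ℝ)) * (pos y 1 - pos v 1) -
          (pos y 0 - pos v 0) * (pos w 1 - pos v 1)) = 0 := by
          linear_combination (pos y 1 - pos v 1 : ℝ) * h 0 - (pos y 0 - pos v 0 : ℝ) * h 1
        exact (mul_eq_zero.1 h3).resolve_right h2
    have hcommon : ∀ v w y, G.Adj v w → G.Adj v y → w ≠ y → ∀ q : Fin 3 → ℝ,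
        q ∈ segment ℝ (gridPoint (pos v)) (gridPoint (pos w)) →
        q ∈ segment ℝ (gridPoint (pos v)) (gridPoint (pos y)) → q = gridPoint (pos v) := by
      intro v w y hvw hvy hwy q hq hq'
      obtain ⟨s, -, -, hs⟩ := exists_of_mem_segment_gridPoint hq
      obtain ⟨t, -, -, ht⟩ := exists_of_mem_segment_gridPoint hq'
      have hs0 := hstar v w y hvw hvy hwy s t fun i => by rw [← hs, ← ht]
      funext i
      simp [gridPoint, hs i, hs0]
    have hcore : ∀ v w x y, G.Adj v w → G.Adj x y → s(v, w) ≠ s(x, y) → pos v 0 = pos x 0 →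
        ∀ q : Fin 3 → ℝ, q ∈ segment ℝ (gridPoint (pos v)) (gridPoint (pos w)) →
        q ∈ segment ℝ (gridPoint (pos x)) (gridPoint (pos y)) →
        ∃ u : V, u ∈ s(v, w) ∧ u ∈ s(x, y) ∧ q = gridPoint (pos u) := by
      intro v w x y hvw hxy hne hx q hq hq'
      by_cases hvx : v = x
      · subst hvx
        exact ⟨v, by simp, by simp, hcommon v w y hvw hxy (by rintro rfl; exact hne rfl) q hq hq'⟩
      by_cases hwy : w = y
      · subst hwy
        exact ⟨w, by simp, by simp, hcommon w v x hvw.symm hxy.symm hvx q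
          (segment_symm ℝ (gridPoint (pos v)) _ ▸ hq) (segment_symm ℝ (gridPoint (pos x)) _ ▸ hq')⟩
      obtain ⟨s, hs0, hs1, hs⟩ := exists_of_mem_segment_gridPoint hq
      obtain ⟨t, ht0, ht1, ht⟩ := exists_of_mem_segment_gridPoint hq'
      exact (hshared v w x y hvw hxy hx hvx hwy s t hs0 hs1 ht0 ht1
        fun i => by rw [← hs, ← ht]).elim
    intro v w x y hvw hxy hne q hq hq'
    have hqs := hq
    have hqs' := hq'
    rw [segment_symm] at hqs hqs'
    by_cases h1 : pos v 0 = pos x 0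
    · exact hcore v w x y hvw hxy hne h1 q hq hq'
    by_cases h2 : pos v 0 = pos y 0
    · rw [Sym2.eq_swap (a := x)] at hne ⊢
      exact hcore v w y x hvw hxy.symm hne h2 q hq hqs'
    by_cases h3 : pos w 0 = pos x 0
    · rw [Sym2.eq_swap (a := v)] at hne ⊢
      exact hcore w v x y hvw.symm hxy hne h3 q hqs hq'
    by_cases h4 : pos w 0 = pos y 0
    · rw [Sym2.eq_swap (a := v), Sym2.eq_swap (a := x)] at hne ⊢
      exact hcore w v y x hvw.symm hxy.symm hne h4 q hqs hqs'
    exfalso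
    obtain ⟨s, -, -, hs⟩ := exists_of_mem_segment_gridPoint hq
    obtain ⟨t, -, -, ht⟩ := exists_of_mem_segment_gridPoint hq'
    have h : ∀ i, (pos x i - pos v i : ℝ) = s * (pos w i - pos v i) -
        t * ((pos y i - pos v i) - (pos x i - pos v i)) := by
      intro i
      linarith [hs i, ht i]
    refine hplane v w x y (hadj v w hvw) h1 h2 h3 h4 (hadj x y hxy) ?_
    rw [← Int.cast_inj (α := ℝ)]
    push_cast
    -- The coefficients are the coordinates of the cross product of `y - x` and `w - v`, which
    -- eliminates both parameters.
    linear_combination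
      ((pos w 2 - pos v 2 : ℝ) * (pos y 1 - pos x 1) - (pos w 1 - pos v 1) * (pos y 2 - pos x 2))
        * h 0 +
      ((pos w 0 - pos v 0 : ℝ) * (pos y 2 - pos x 2) - (pos w 2 - pos v 2) * (pos y 0 - pos x 0))
        * h 1 +
      ((pos w 1 - pos v 1 : ℝ) * (pos y 0 - pos x 0) - (pos w 0 - pos v 0) * (pos y 1 - pos x 1))
        * h 2

variable [Fintype V] [Nonempty V]

theorem GridDrawing.size_le (D : G.GridDrawing) (i : Fin 3) (N : ℕ)
    (h : ∀ v, 0 ≤ D.pos v i ∧ D.pos v i < N) : D.size i ≤ N := by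
  have h1 : Finset.univ.sup' Finset.univ_nonempty (fun v => D.pos v i) < N := by
    rw [Finset.sup'_lt_iff]
    exact fun v _ => (h v).2
  have h2 : 0 ≤ Finset.univ.inf' Finset.univ_nonempty (fun v => D.pos v i) := by
    rw [Finset.le_inf'_iff]
    exact fun v _ => (h v).1
  have h3 : 0 ≤ Finset.univ.sup' Finset.univ_nonempty (fun v => D.pos v i) :=
    let ⟨v⟩ := ‹Nonempty V›
    (h v).1.trans (Finset.le_sup' (fun v => D.pos v i) (Finset.mem_univ v))
  unfold size
  omega

end SimpleGraph

theorem ZMod.intCast_sub_ne_zero_of_lt {p : ℕ} {a b : ℤ} (ha : 0 ≤ a ∧ a < p)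
    (hb : 0 ≤ b ∧ b < p) (hab : a ≠ b) : (a - b : ZMod p) ≠ 0 := by
  intro h
  rw [sub_eq_zero, ZMod.intCast_eq_intCast_iff, Int.ModEq, Int.emod_eq_of_lt ha.1 ha.2,
    Int.emod_eq_of_lt hb.1 hb.2] at h
  exact hab h

/-! ### Drawings on the moment curve modulo a prime. -/

namespace SimpleGraph

variable {V : Type u} {G : SimpleGraph V}

/-- A grid drawing whose vertices lie on the moment curve modulo a prime. -/
def GridDrawing.ofMomentCurve (p : ℕ) [Fact p.Prime] (pos : V → Fin 3 → ℤ)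
    (inj : Function.Injective pos) (hpos : ∀ v, 0 ≤ pos v 0 ∧ pos v 0 < p)
    (hpos1 : ∀ v, (pos v 1 : ZMod p) = (pos v 0 : ZMod p) ^ 2)
    (hpos2 : ∀ v, (pos v 2 : ZMod p) = (pos v 0 : ZMod p) ^ 3)
    (hadj : ∀ v w, G.Adj v w → pos v 0 ≠ pos w 0)
    -- Non-collinearity of the projections is derived inside the construction and offered here for
    -- excluding the remaining crossings.
    (hshared : (∀ a b c, pos a 0 ≠ pos b 0 → pos a 0 ≠ pos c 0 → pos b 0 ≠ pos c 0 →
      (pos b 0 - pos a 0) * (pos c 1 - pos a 1) - (pos c 0 - pos a 0) * (pos b 1 - pos a 1) ≠ 0) →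
      ∀ v w x y, G.Adj v w → G.Adj x y → pos v 0 = pos x 0 → v ≠ x → w ≠ y →
      ∀ s t : ℝ, 0 ≤ s → s ≤ 1 → 0 ≤ t → t ≤ 1 →
      ¬ ∀ i, (pos v i + s * (pos w i - pos v i) : ℝ) = pos x i + t * (pos y i - pos x i)) :
    G.GridDrawing := by
  have hne : ∀ a b, pos a 0 ≠ pos b 0 → (pos b 0 - pos a 0 : ZMod p) ≠ 0 := fun a b h =>
    ZMod.intCast_sub_ne_zero_of_lt (hpos b) (hpos a) h.symm
  have hline : ∀ a b c, pos a 0 ≠ pos b 0 → pos a 0 ≠ pos c 0 → pos b 0 ≠ pos c 0 →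
      (pos b 0 - pos a 0) * (pos c 1 - pos a 1) -
        (pos c 0 - pos a 0) * (pos b 1 - pos a 1) ≠ 0 := by
    intro a b c hab hac hbc h
    have h' := congrArg (Int.cast : ℤ → ZMod p) h
    push_cast [hpos1] at h'
    refine mul_ne_zero (mul_ne_zero (hne a b hab) (hne a c hac)) (hne b c hbc) ?_
    linear_combination h'
  refine GridDrawing.ofGeneralPosition pos inj hadj hline ?_ (hshared hline)
  intro a b c e hab hac hae hbc hbe hce h
  have h' := congrArg (Int.cast : ℤ → ZMod p) h
  push_cast [hpos1, hpos2] at h'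
  -- Modulo `p` the determinant is the Vandermonde product of these six differences.
  refine mul_ne_zero (mul_ne_zero (mul_ne_zero (hne a b hab) (hne a c hac)) (hne a e hae))
    (mul_ne_zero (mul_ne_zero (hne b c hbc) (hne b e hbe)) (hne c e hce)) ?_
  linear_combination h'

@[simp]
theorem GridDrawing.ofMomentCurve_pos (p : ℕ) [Fact p.Prime] (pos : V → Fin 3 → ℤ)
    (inj : Function.Injective pos) (h0 h1 h2 hadj hshared) :
    (ofMomentCurve (G := G) p pos inj h0 h1 h2 hadj hshared).pos = pos := rfl

/-- Two segments that start at distinct points of a vertical line and end over points that are not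
collinear with that line are disjoint. -/
theorem disjoint_of_same_track {a b c e : Fin 3 → ℤ} (hac : a ≠ c) (h0 : a 0 = c 0)
    (h1 : a 1 = c 1)
    (hline : (b 0 - a 0) * (e 1 - a 1) - (e 0 - a 0) * (b 1 - a 1) ≠ 0) (s t : ℝ) :
    ¬ ∀ i, (a i + s * (b i - a i) : ℝ) = c i + t * (e i - c i) := by
  intro h
  have e0 := h 0
  have e1 := h 1
  rw [← h0] at e0
  rw [← h1] at e1
  have hline' : ((b 0 - a 0 : ℝ)) * (e 1 - a 1) - (e 0 - a 0) * (b 1 - a 1) ≠ 0 := by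
    exact_mod_cast hline
  have hs : s = 0 := by
    have : s * ((b 0 - a 0 : ℝ) * (e 1 - a 1) - (e 0 - a 0) * (b 1 - a 1)) = 0 := by
      linear_combination (e 1 - a 1 : ℝ) * e0 - (e 0 - a 0 : ℝ) * e1
    exact (mul_eq_zero.1 this).resolve_right hline'
  have ht : t = 0 := by
    have : t * ((b 0 - a 0 : ℝ) * (e 1 - a 1) - (e 0 - a 0) * (b 1 - a 1)) = 0 := by
      linear_combination (b 1 - a 1 : ℝ) * e0 - (b 0 - a 0 : ℝ) * e1
    exact (mul_eq_zero.1 this).resolve_right hline'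
  refine hac (funext fun i => ?_)
  have := h i
  rw [hs, ht, zero_mul, zero_mul, add_zero, add_zero] at this
  exact_mod_cast this

/-- A proper colouring with less than `p` colours in which any two edges between the same pair
of colour classes share a vertex gives a `p × p × pl` drawing, where `l` bounds the size of the
colour classes. -/
theorem exists_gridDrawing_of_strongStar [Fintype V] [Nonempty V] {p l : ℕ} (hp : p.Prime)
    (f : V → ℕ) (hf : ∀ v, f v < p) (hproper : ∀ v w, G.Adj v w → f v ≠ f w)
    (hstar : ∀ v w x y, G.Adj v w → G.Adj x y → f v = f x → f w = f y → v = x ∨ w = y)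
    (hcard : ∀ c, {v | f v = c}.ncard ≤ l) :
    ∃ D : G.GridDrawing, D.width ≤ p ∧ D.depth ≤ p ∧ D.height ≤ p * l := by
  have := Fact.mk hp
  obtain ⟨h, hl, hinj⟩ := exists_height_of_ncard_fiber_le f hcard
  -- Stacking a class in steps of `p` leaves the residue of the third coordinate unchanged.
  let pos : V → Fin 3 → ℤ := fun v =>
    ![(f v : ℕ), (f v ^ 2 % p : ℕ), (f v ^ 3 % p + p * h v : ℕ)]
  have pos0 : ∀ v, pos v 0 = (f v : ℕ) := fun _ => rfl
  have pos1 : ∀ v, pos v 1 = (f v ^ 2 % p : ℕ) := fun _ => rfl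
  have pos2 : ∀ v, pos v 2 = (f v ^ 3 % p + p * h v : ℕ) := fun _ => rfl
  have inj : Function.Injective pos := by
    intro v w hvw
    have h0 : f v = f w := by
      have := congrFun hvw 0
      rw [pos0, pos0] at this
      exact_mod_cast this
    have h2 := congrFun hvw 2
    rw [pos2, pos2, Nat.cast_inj, h0, Nat.add_left_cancel_iff] at h2
    exact hinj v w h0 (Nat.eq_of_mul_eq_mul_left hp.pos h2)
  refine ⟨GridDrawing.ofMomentCurve p pos inj ?_ ?_ ?_ ?_ ?_, ?_, ?_, ?_⟩
  · intro v
    rw [pos0]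
    exact ⟨by positivity, by exact_mod_cast hf v⟩
  · intro v
    rw [pos0, pos1]
    simp
  · intro v
    rw [pos0, pos2]
    simp
  · intro v w hvw
    rw [pos0, pos0]
    exact_mod_cast hproper v w hvw
  · intro hline v w x y hvw hxy hx hvx hwy s t _ _ _ _
    have hfx : f v = f x := by
      rw [pos0, pos0] at hx
      exact_mod_cast hx
    have hwy0 : pos w 0 ≠ pos y 0 := by
      intro hw
      rw [pos0, pos0] at hw
      rcases hstar v w x y hvw hxy hfx (by exact_mod_cast hw) with h | h
      · exact hvx h
      · exact hwy h
    have hxne : ∀ v w, G.Adj v w → pos v 0 ≠ pos w 0 := by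
      intro v w hvw
      rw [pos0, pos0]
      exact_mod_cast hproper v w hvw
    exact disjoint_of_same_track (fun h => hvx (inj h)) hx (by rw [pos1, pos1, hfx])
      (hline v w y (hxne v w hvw) (hx ▸ hxne x y hxy) hwy0) s t
  · refine GridDrawing.size_le _ 0 p fun v => ?_
    rw [GridDrawing.ofMomentCurve_pos, pos0]
    exact ⟨by positivity, by exact_mod_cast hf v⟩
  · refine GridDrawing.size_le _ 1 p fun v => ?_
    rw [GridDrawing.ofMomentCurve_pos, pos1]
    exact ⟨by positivity, by exact_mod_cast Nat.mod_lt _ hp.pos⟩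
  · refine GridDrawing.size_le _ 2 (p * l) fun v => ?_
    rw [GridDrawing.ofMomentCurve_pos, pos2]
    refine ⟨by positivity, ?_⟩
    have h1 := Nat.mod_lt (f v ^ 3) hp.pos
    have h2 : p * (h v + 1) ≤ p * l := Nat.mul_le_mul_left p (hl v)
    rw [mul_add, mul_one] at h2
    exact_mod_cast (by omega : f v ^ 3 % p + p * h v < p * l)

/-! ### Crossing estimates near the saddle `z = Lxy`. -/

theorem abs_convexComb_sub_le {s t M a b c e : ℝ} (hs0 : 0 ≤ s) (hs1 : s ≤ 1) (ht0 : 0 ≤ t)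
    (ht1 : t ≤ 1) (ha : a ∈ Set.Icc 0 M) (hb : b ∈ Set.Icc 0 M) (hc : c ∈ Set.Icc 0 M)
    (he : e ∈ Set.Icc 0 M) : |(1 - t) * c + t * e - ((1 - s) * a + s * b)| ≤ M := by
  have key : ∀ r x y : ℝ, 0 ≤ r → r ≤ 1 → x ∈ Set.Icc 0 M → y ∈ Set.Icc 0 M →
      (1 - r) * x + r * y ∈ Set.Icc 0 M := fun r x y h0 h1 hx hy =>
    convex_Icc 0 M hx hy (by linarith) h0 (by ring)
  have h1 := key s a b hs0 hs1 ha hb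
  have h2 := key t c e ht0 ht1 hc he
  rw [abs_le]
  constructor <;> linarith [h1.1, h1.2, h2.1, h2.2]

/-- If two segments starting in the plane `x = i` meet, and the heights of their endpoints are
within `M` above the surface `z = L * x * y`, then the meeting point is near the start, or the
second coordinates of the ends are near each other. -/
theorem abs_mul_sub_mul_le_of_meet {i k k' y₁ y₂ y₃ y₄ a b c e L M s t : ℝ} (hL : 0 ≤ L)
    (hs0 : 0 ≤ s) (hs1 : s ≤ 1) (ht0 : 0 ≤ t) (ht1 : t ≤ 1)
    (ha : a ∈ Set.Icc 0 M) (hb : b ∈ Set.Icc 0 M) (hc : c ∈ Set.Icc 0 M) (he : e ∈ Set.Icc 0 M)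
    (h0 : s * (k - i) = t * (k' - i))
    (h1 : y₁ + s * (y₂ - y₁) = y₃ + t * (y₄ - y₃))
    (h2 : (L * i * y₁ + a) + s * ((L * k * y₂ + b) - (L * i * y₁ + a)) =
      (L * i * y₃ + c) + t * ((L * k' * y₄ + e) - (L * i * y₃ + c))) :
    |s * (k - i)| * |y₂ - y₄| * L ≤ M := by
  have h := abs_convexComb_sub_le hs0 hs1 ht0 ht1 ha hb hc he
  -- Agreement in `x` and `y` cancels all saddle terms but one, which the residual heights,
  -- differing by at most `M`, must balance.
  have heq : (1 - t) * c + t * e - ((1 - s) * a + s * b) = s * (k - i) * (y₂ - y₄) * L := by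
    linear_combination (-1) * h2 + L * i * h1 + L * y₄ * h0
  rwa [heq, abs_mul, abs_mul, abs_of_nonneg hL] at h

/-- The estimate read from the two planes gives `s * L ≤ M` and `(1 - s) * L ≤ M`; add them. -/
theorem le_of_meet_of_two_planes {i k y₁ y₂ y₃ y₄ a b c e L M s t : ℝ} (hL : 0 ≤ L)
    (hs0 : 0 ≤ s) (hs1 : s ≤ 1)
    (ha : a ∈ Set.Icc 0 M) (hb : b ∈ Set.Icc 0 M) (hc : c ∈ Set.Icc 0 M) (he : e ∈ Set.Icc 0 M)
    (hk : 1 ≤ |k - i|) (hy : 1 ≤ |y₁ - y₃|) (hy' : 1 ≤ |y₂ - y₄|)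
    (h0 : s = t)
    (h1 : y₁ + s * (y₂ - y₁) = y₃ + t * (y₄ - y₃))
    (h2 : (L * i * y₁ + a) + s * ((L * k * y₂ + b) - (L * i * y₁ + a)) =
      (L * i * y₃ + c) + t * ((L * k * y₄ + e) - (L * i * y₃ + c))) :
    L ≤ 2 * M := by
  subst h0
  have A := abs_mul_sub_mul_le_of_meet hL hs0 hs1 hs0 hs1 ha hb hc he rfl h1 h2
  have B := abs_mul_sub_mul_le_of_meet (i := k) (k := i) (k' := i) (y₁ := y₂) (y₂ := y₁)
    (y₃ := y₄) (y₄ := y₃) (a := b) (b := a) (c := e) (e := c) (s := 1 - s) (t := 1 - s) hL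
    (by linarith) (by linarith) (by linarith) (by linarith) hb ha he hc rfl
    (by linear_combination h1) (by linear_combination h2)
  rw [abs_mul, abs_of_nonneg hs0] at A
  rw [abs_mul, abs_of_nonneg (by linarith : 0 ≤ 1 - s), abs_sub_comm i k] at B
  have hA : s * L ≤ s * |k - i| * |y₂ - y₄| * L := by
    have : 1 ≤ |k - i| * |y₂ - y₄| := one_le_mul_of_one_le_of_one_le hk hy'
    have := mul_le_mul_of_nonneg_left this (mul_nonneg hs0 hL)
    linarith
  have hB : (1 - s) * L ≤ (1 - s) * |k - i| * |y₁ - y₃| * L := by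
    have : 1 ≤ |k - i| * |y₁ - y₃| := one_le_mul_of_one_le_of_one_le hk hy
    have := mul_le_mul_of_nonneg_left this (mul_nonneg (by linarith : 0 ≤ 1 - s) hL)
    linarith
  linarith

/-- Starts at distance at least `1` cannot meet too early: the second coordinates force `1 ≤ (s + t)
* Y`. So `|s * (k - i)|` is at least `1 / (2 * Y)`, while the far ends are `R` apart. -/
theorem le_of_meet_of_three_planes {i k k' y₁ y₂ y₃ y₄ a b c e L M Y R s t : ℝ} (hL : 0 ≤ L)
    (hs0 : 0 ≤ s) (hs1 : s ≤ 1) (ht0 : 0 ≤ t) (ht1 : t ≤ 1)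
    (ha : a ∈ Set.Icc 0 M) (hb : b ∈ Set.Icc 0 M) (hc : c ∈ Set.Icc 0 M) (he : e ∈ Set.Icc 0 M)
    (hk : 1 ≤ |k - i|) (hk' : 1 ≤ |k' - i|) (hy : 1 ≤ |y₁ - y₃|)
    (hy₁ : y₁ ∈ Set.Icc 0 Y) (hy₂ : y₂ ∈ Set.Icc 0 Y) (hy₃ : y₃ ∈ Set.Icc 0 Y)
    (hy₄ : y₄ ∈ Set.Icc 0 Y) (hR : R ≤ |y₂ - y₄|)
    (h0 : s * (k - i) = t * (k' - i))
    (h1 : y₁ + s * (y₂ - y₁) = y₃ + t * (y₄ - y₃))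
    (h2 : (L * i * y₁ + a) + s * ((L * k * y₂ + b) - (L * i * y₁ + a)) =
      (L * i * y₃ + c) + t * ((L * k' * y₄ + e) - (L * i * y₃ + c))) :
    R * L ≤ 2 * Y * M := by
  have A := abs_mul_sub_mul_le_of_meet hL hs0 hs1 ht0 ht1 ha hb hc he h0 h1 h2
  have hY : 0 ≤ Y := hy₁.1.trans hy₁.2
  have hs : s ≤ |s * (k - i)| := by
    rw [abs_mul, abs_of_nonneg hs0]
    exact le_mul_of_one_le_right hs0 hk
  have ht : t ≤ |s * (k - i)| := by
    rw [h0, abs_mul, abs_of_nonneg ht0]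
    exact le_mul_of_one_le_right ht0 hk'
  have hdist : ∀ y y' : ℝ, y ∈ Set.Icc 0 Y → y' ∈ Set.Icc 0 Y → |y - y'| ≤ Y := by
    intro y y' h h'
    rw [abs_le]
    constructor <;> linarith [h.1, h.2, h'.1, h'.2]
  have h3 : |y₁ - y₃| ≤ t * Y + s * Y := by
    have heq : y₁ - y₃ = t * (y₄ - y₃) - s * (y₂ - y₁) := by linarith
    rw [heq]
    refine (abs_sub _ _).trans (add_le_add ?_ ?_)
    · rw [abs_mul, abs_of_nonneg ht0]
      exact mul_le_mul_of_nonneg_left (hdist _ _ hy₄ hy₃) ht0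
    · rw [abs_mul, abs_of_nonneg hs0]
      exact mul_le_mul_of_nonneg_left (hdist _ _ hy₂ hy₁) hs0
  have h4 : 1 ≤ 2 * Y * |s * (k - i)| := by
    have := mul_le_mul_of_nonneg_right hs hY
    have := mul_le_mul_of_nonneg_right ht hY
    linarith
  calc R * L ≤ |y₂ - y₄| * L := mul_le_mul_of_nonneg_right hR hL
    _ ≤ (2 * Y * |s * (k - i)|) * (|y₂ - y₄| * L) :=
      le_mul_of_one_le_left (mul_nonneg (abs_nonneg _) hL) h4
    _ = 2 * Y * (|s * (k - i)| * |y₂ - y₄| * L) := by ring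
    _ ≤ 2 * Y * M := mul_le_mul_of_nonneg_left A (by linarith)

end SimpleGraph

/-! ### Drawings in a bounded number of planes. -/

namespace SimpleGraph

variable {V : Type u} {G : SimpleGraph V}

/-- The second coordinates of a drawing with `N` vertical tracks in each of several planes: planes
occupy far apart intervals, and the coordinates are congruent to squares modulo `p`. -/
def trackCoord (p N k j : ℕ) : ℕ := p * (2 * N * k + j) + k ^ 2

theorem trackCoord_le {p N c k j : ℕ} (hcp : c ≤ p) (hk : k < c) (hj : j < N) :
    trackCoord p N k j ≤ 3 * p * N * c := by
  have h1 : 2 * N * k + j ≤ 2 * N * c := by nlinarith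
  have h2 : k ^ 2 ≤ p * c := by nlinarith
  have h3 : p * c * 1 ≤ p * c * N := Nat.mul_le_mul_left _ (by omega)
  have h4 := Nat.mul_le_mul_left p h1
  unfold trackCoord
  linarith

/-- The tracks of a plane fill half of a period `2 * p * N`; the other half is the gap, and the
increasing squares do not shrink it. -/
theorem trackCoord_add_le {p N k k' j j' : ℕ} (hj : j < N) (hkk : k < k') :
    trackCoord p N k j + p * N ≤ trackCoord p N k' j' := by
  have h1 : 2 * N * k + j + N ≤ 2 * N * k' + j' := by nlinarith
  have h2 : k ^ 2 ≤ k' ^ 2 := Nat.pow_le_pow_left hkk.le 2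
  have h3 := Nat.mul_le_mul_left p h1
  unfold trackCoord
  linarith

theorem le_abs_trackCoord_sub {p N k k' j j' : ℕ} (hj : j < N) (hj' : j' < N) (hkk : k ≠ k') :
    (p * N : ℝ) ≤ |(trackCoord p N k j : ℝ) - trackCoord p N k' j'| := by
  rcases lt_or_gt_of_ne hkk with h | h
  · have h1 : (trackCoord p N k j + p * N : ℝ) ≤ trackCoord p N k' j' := by
      exact_mod_cast trackCoord_add_le hj h
    rw [abs_sub_comm]
    exact le_trans (by linarith) (le_abs_self _)
  · have h1 : (trackCoord p N k' j' + p * N : ℝ) ≤ trackCoord p N k j := by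
      exact_mod_cast trackCoord_add_le hj' h
    exact le_trans (by linarith) (le_abs_self _)

theorem one_le_abs_natCast_sub {a b : ℕ} (h : a ≠ b) : (1 : ℝ) ≤ |(a : ℝ) - b| := by
  have h1 : (1 : ℤ) ≤ |(a : ℤ) - b| := Int.one_le_abs (sub_ne_zero.2 (by exact_mod_cast h))
  exact_mod_cast h1

/-- A proper colouring with `c ≤ p` colours, and an assignment of `N` tracks such that any two
edges between the same pair of tracks share a vertex, give a drawing in `c` parallel planes. -/
theorem exists_gridDrawing_of_coloring_of_strongStar [Fintype V] [Nonempty V] {p c N l : ℕ}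
    (hp : p.Prime) (hcp : c ≤ p) (k : V → ℕ) (hk : ∀ v, k v < c)
    (hproper : ∀ v w, G.Adj v w → k v ≠ k w) (f : V → ℕ) (hf : ∀ v, f v < N)
    (hstar : ∀ v w x y, G.Adj v w → G.Adj x y → f v = f x → f w = f y → v = x ∨ w = y)
    (hcard : ∀ j, {v | f v = j}.ncard ≤ l) :
    ∃ D : G.GridDrawing, D.width ≤ c ∧ D.depth ≤ 3 * p * N * c + 1 ∧
      D.height ≤ (6 * c * (p * l) + 1) * c * (3 * p * N * c) + p * l := by
  have := Fact.mk hp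
  obtain ⟨h, hl, hinj⟩ := exists_height_of_ncard_fiber_le f hcard
  -- `L` is `1` modulo `p`, so `z` reduces to `k * k ^ 2`. It exceeds by one the bound `2 * (3 * p *
  -- N * c) * (p * l) / (p * N)` that a crossing over three planes would impose.
  set L := 6 * c * (p * l) + 1 with hL
  let Y : V → ℕ := fun v => trackCoord p N (k v) (f v)
  let pos : V → Fin 3 → ℤ := fun v => ![(k v : ℕ), (Y v : ℕ), (L * k v * Y v + p * h v : ℕ)]
  have pos0 : ∀ v, pos v 0 = (k v : ℕ) := fun _ => rfl
  have pos1 : ∀ v, pos v 1 = (Y v : ℕ) := fun _ => rfl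
  have pos2 : ∀ v, pos v 2 = (L * k v * Y v + p * h v : ℕ) := fun _ => rfl
  have hN : 0 < N := (Nat.zero_le _).trans_lt (hf (Classical.arbitrary V))
  have hYf : ∀ v w, k v = k w → Y v = Y w → f v = f w := by
    intro v w hkv hY
    simp only [Y, trackCoord, hkv, Nat.add_right_cancel_iff] at hY
    exact Nat.add_left_cancel (Nat.eq_of_mul_eq_mul_left hp.pos hY)
  have hYle : ∀ v, Y v ≤ 3 * p * N * c := fun v => trackCoord_le hcp (hk v) (hf v)
  have hfine : ∀ v, p * h v + p ≤ p * l := fun v => by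
    have := Nat.mul_le_mul_left p (hl v)
    rwa [Nat.mul_succ] at this
  have inj : Function.Injective pos := by
    intro v w hvw
    have h0 : k v = k w := by
      have := congrFun hvw 0
      rw [pos0, pos0] at this
      exact_mod_cast this
    have h1 : Y v = Y w := by
      have := congrFun hvw 1
      rw [pos1, pos1] at this
      exact_mod_cast this
    have h2 := congrFun hvw 2
    rw [pos2, pos2, Nat.cast_inj, h0, h1, Nat.add_left_cancel_iff] at h2
    exact hinj v w (hYf v w h0 h1) (Nat.eq_of_mul_eq_mul_left hp.pos h2)
  have hxne : ∀ v w, G.Adj v w → pos v 0 ≠ pos w 0 := by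
    intro v w hvw
    rw [pos0, pos0]
    exact_mod_cast hproper v w hvw
  have hY1 : ∀ v, ((Y v : ℕ) : ZMod p) = (k v : ZMod p) ^ 2 := by
    intro v
    simp [Y, trackCoord]
  refine ⟨GridDrawing.ofMomentCurve p pos inj ?_ ?_ ?_ hxne ?_, ?_, ?_, ?_⟩
  · intro v
    rw [pos0]
    exact ⟨by positivity, by exact_mod_cast (hk v).trans_le hcp⟩
  · intro v
    rw [pos0, pos1]
    simpa using hY1 v
  · intro v
    rw [pos0, pos2]
    push_cast [hY1, hL]
    simp
    ring
  · intro hline v w x y hvw hxy hx hvx hwy s t hs0 hs1 ht0 ht1 hmeet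
    have hkx : k v = k x := by
      rw [pos0, pos0] at hx
      exact_mod_cast hx
    have hkvw := hproper v w hvw
    have hkxy := hkx ▸ hproper x y hxy
    have e0 := hmeet 0
    have e1 := hmeet 1
    have e2 := hmeet 2
    simp only [pos0] at e0
    simp only [pos1] at e1
    simp only [pos2] at e2
    push_cast at e0 e1 e2
    rw [← hkx] at e0 e2
    have e0' : s * ((k w : ℝ) - k v) = t * (k y - k v) := by linarith
    have hwv0 : (k w : ℝ) - k v ≠ 0 := sub_ne_zero.2 (by exact_mod_cast hkvw.symm)
    have hyv0 : (k y : ℝ) - k v ≠ 0 := sub_ne_zero.2 (by exact_mod_cast hkxy.symm)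
    have hs : s ≠ 0 := by
      rintro rfl
      have ht : t = 0 := by
        rw [zero_mul] at e0'
        exact (mul_eq_zero.1 e0'.symm).resolve_right hyv0
      refine hvx (inj (funext fun i => ?_))
      have := hmeet i
      rw [ht, zero_mul, zero_mul, add_zero, add_zero] at this
      exact_mod_cast this
    by_cases hkwy : k w = k y
    · have hst : s = t := by
        rw [← hkwy] at e0'
        exact mul_right_cancel₀ hwv0 e0'
      have hs1' : 1 - s ≠ 0 := by
        intro h1
        have hs' : s = 1 := by linarith
        refine hwy (inj (funext fun i => ?_))
        have := hmeet i
        rw [← hst, hs', one_mul, one_mul, add_sub_cancel, add_sub_cancel] at this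
        exact_mod_cast this
      have e1' : (1 - s) * ((Y v : ℝ) - Y x) + s * ((Y w : ℝ) - Y y) = 0 := by
        rw [← hst] at e1
        linear_combination e1
      -- Both weights in `e1'` are nonzero, so the edges share both tracks, against the star
      -- property, or neither, against the saddle estimate.
      have hYiff : Y v = Y x ↔ Y w = Y y := by
        constructor
        · intro hY
          rw [hY, sub_self, mul_zero, zero_add] at e1'
          exact_mod_cast sub_eq_zero.1 ((mul_eq_zero.1 e1').resolve_left hs)
        · intro hY
          rw [hY, sub_self, mul_zero, add_zero] at e1'
          exact_mod_cast sub_eq_zero.1 ((mul_eq_zero.1 e1').resolve_left hs1')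
      by_cases hYv : Y v = Y x
      · rcases hstar v w x y hvw hxy (hYf v x hkx hYv) (hYf w y hkwy (hYiff.1 hYv)) with h | h
        · exact hvx h
        · exact hwy h
      have hYw : Y w ≠ Y y := fun h => hYv (hYiff.2 h)
      rw [← hkwy] at e2
      have hIcc : ∀ v, (p * h v : ℝ) ∈ Set.Icc (0 : ℝ) (p * l) := fun v =>
        ⟨by positivity, by exact_mod_cast (Nat.le_add_right _ p).trans (hfine v)⟩
      have hle := le_of_meet_of_two_planes (L := L) (by positivity) hs0 hs1 (hIcc v) (hIcc w)
        (hIcc x) (hIcc y) (one_le_abs_natCast_sub hkvw.symm) (one_le_abs_natCast_sub hYv)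
        (one_le_abs_natCast_sub hYw) hst e1 e2
      have hle' : L ≤ 2 * (p * l) := by exact_mod_cast hle
      have hc : 1 * (p * l) ≤ c * (p * l) :=
        Nat.mul_le_mul_right _ ((Nat.zero_le _).trans_lt (hk v))
      rw [hL] at hle'
      linarith
    · by_cases hYv : Y v = Y x
      · refine disjoint_of_same_track (fun h => hvx (inj h)) hx (by rw [pos1, pos1, hYv])
          (hline v w y (hxne v w hvw) (hx ▸ hxne x y hxy) ?_) s t hmeet
        rw [pos0, pos0]
        exact_mod_cast hkwy
      have hIcc : ∀ v, (p * h v : ℝ) ∈ Set.Icc (0 : ℝ) (p * l) := fun v =>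
        ⟨by positivity, by exact_mod_cast (Nat.le_add_right _ p).trans (hfine v)⟩
      have hYIcc : ∀ v, (Y v : ℝ) ∈ Set.Icc (0 : ℝ) (3 * p * N * c) := fun v =>
        ⟨by positivity, by exact_mod_cast hYle v⟩
      have hle := le_of_meet_of_three_planes (L := L) (R := p * N) (by positivity) hs0 hs1 ht0 ht1
        (hIcc v) (hIcc w) (hIcc x) (hIcc y) (one_le_abs_natCast_sub hkvw.symm)
        (one_le_abs_natCast_sub hkxy.symm) (one_le_abs_natCast_sub hYv) (hYIcc v) (hYIcc w)
        (hYIcc x) (hYIcc y) (le_abs_trackCoord_sub (hf w) (hf y) hkwy) e0' e1 e2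
      have hle' : p * N * L ≤ 2 * (3 * p * N * c) * (p * l) := by exact_mod_cast hle
      have hpN : 0 < p * N := Nat.mul_pos hp.pos hN
      have heq : p * N * L = 2 * (3 * p * N * c) * (p * l) + p * N := by
        rw [hL]
        ring
      omega
  · refine GridDrawing.size_le _ 0 c fun v => ?_
    rw [GridDrawing.ofMomentCurve_pos, pos0]
    exact ⟨by positivity, by exact_mod_cast hk v⟩
  · refine GridDrawing.size_le _ 1 _ fun v => ?_
    rw [GridDrawing.ofMomentCurve_pos, pos1]
    exact ⟨by positivity, by exact_mod_cast Nat.lt_succ_of_le (hYle v)⟩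
  · refine GridDrawing.size_le _ 2 _ fun v => ?_
    rw [GridDrawing.ofMomentCurve_pos, pos2]
    refine ⟨by positivity, ?_⟩
    have h1 : L * k v * Y v ≤ L * c * (3 * p * N * c) :=
      Nat.mul_le_mul (Nat.mul_le_mul_left _ (hk v).le) (hYle v)
    have h2 := hfine v
    have h3 := hp.pos
    exact_mod_cast (by omega : L * k v * Y v + p * h v < L * c * (3 * p * N * c) + p * l)

end SimpleGraph

/-! ### Choice of parameters and the final bounds. -/

namespace SimpleGraph

variable {V : Type u} {G : SimpleGraph V}

theorem natCast_sqrt_add_one_le {a : ℕ} (ha : 1 ≤ a) :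
    ((Nat.sqrt a + 1 : ℕ) : ℝ) ≤ 2 * Real.sqrt a := by
  have h1 : ((Nat.sqrt a : ℕ) : ℝ) ≤ Real.sqrt a := Real.nat_sqrt_le_real_sqrt
  have h2 : 1 ≤ Real.sqrt a := Real.one_le_sqrt.2 (by exact_mod_cast ha)
  push_cast
  linarith

theorem mul_div_add_one_le (s n : ℕ) : s * (n / s + 1) ≤ n + s := by
  rw [mul_add, mul_one]
  exact Nat.add_le_add_right (Nat.mul_div_le n s) s

variable [Fintype V] [Nonempty V]

/-- Drawings of degenerate graphs with equal width and depth. -/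
theorem exists_gridDrawing_of_one_le_ncard_edgeSet (G : SimpleGraph V)
    (hm : 1 ≤ G.edgeSet.ncard) :
    ∃ D : G.GridDrawing,
      D.width ≤ 22 * (Nat.sqrt (G.degeneracy * G.edgeSet.ncard) + 1) ∧
      D.depth ≤ 22 * (Nat.sqrt (G.degeneracy * G.edgeSet.ncard) + 1) ∧
      D.height ≤ 44 * Fintype.card V := by
  set d := G.degeneracy with hd
  set m := G.edgeSet.ncard with hm'
  set s := Nat.sqrt (d * m) + 1 with hs
  have hds : d * m < s * s := Nat.lt_succ_sqrt _
  have hdm : d ≤ m := G.degeneracy_le_ncard_edgeSet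
  have hd1 : 1 ≤ d := one_le_degeneracy hm
  have hd_le : d ≤ s := (Nat.mul_self_lt_mul_self_iff.1
    ((Nat.mul_le_mul_left d hdm).trans_lt hds)).le
  have hn : 0 < Fintype.card V := Fintype.card_pos
  -- For `n ≤ s` every vertex gets its own colour. Otherwise the height is at most `22 * s * (n / s
  -- + 1) ≤ 22 * (n + s)`, which is linear in `n` only because `s < n`.
  rcases le_or_gt (Fintype.card V) s with hns | hns
  · obtain ⟨p, hp, hnp, hp2⟩ := Nat.exists_prime_lt_and_le_two_mul _ hn.ne'
    have hinj : ∀ v w : V, (Fintype.equivFin V v : ℕ) = Fintype.equivFin V w → v = w :=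
      fun v w h => (Fintype.equivFin V).injective (Fin.ext h)
    obtain ⟨D, h1, h2, h3⟩ := exists_gridDrawing_of_strongStar (G := G) (l := 1) hp
      (fun v => Fintype.equivFin V v) (fun v => (Fin.is_lt _).trans hnp)
      (fun v w hvw h => hvw.ne (hinj v w h)) (fun v w x y _ _ h _ => Or.inl (hinj v x h))
      (fun c => (Set.ncard_le_one_iff (Set.toFinite _)).2 fun {a b} ha hb => hinj a b (Eq.trans ha (Eq.symm hb)))
    exact ⟨D, by omega, by omega, by omega⟩
  · obtain ⟨f, hf, hproper, hstar, hcard⟩ :=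
      G.isDegenerate_degeneracy.exists_strongStar hd1 hd_le hds
    obtain ⟨p, hp, hsp, hp2⟩ := Nat.exists_prime_lt_and_le_two_mul (11 * s) (by omega)
    obtain ⟨D, h1, h2, h3⟩ := exists_gridDrawing_of_strongStar hp f
      (fun v => (hf v).trans hsp) hproper hstar hcard
    refine ⟨D, by omega, by omega, h3.trans ?_⟩
    have h4 := mul_div_add_one_le s (Fintype.card V)
    have h5 := Nat.mul_le_mul_right (Fintype.card V / s + 1) hp2
    linarith

/-- Drawings of graphs of bounded degeneracy in a bounded number of planes. -/
theorem IsDegenerate.exists_gridDrawing {b : ℕ} (hG : G.IsDegenerate b) :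
    ∃ D : G.GridDrawing, D.width ≤ b + 1 ∧
      D.depth ≤ 67 * (b + 1) ^ 3 * (Nat.sqrt (Fintype.card V) + 1) ∧
      D.height ≤ 2904 * (b + 1) ^ 6 * Fintype.card V := by
  -- Taking `b + 1` keeps `d` positive when `b = 0`, and is also the number of planes.
  set d := b + 1 with hd
  set n := Fintype.card V with hn'
  set s := d * (Nat.sqrt n + 1) with hs
  have hn : 0 < n := Fintype.card_pos
  have hd1 : 1 ≤ d := by omega
  have hds : d ≤ s := Nat.le_mul_of_pos_right d (Nat.succ_pos _)
  have hsd : s ≤ 2 * d * n := by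
    have := Nat.sqrt_le_self n
    calc s ≤ d * (n + n) := Nat.mul_le_mul_left _ (by omega)
      _ = 2 * d * n := by ring
  have hdm : d * G.edgeSet.ncard < s * s := by
    have h1 := (hG.mono (Nat.le_succ b)).ncard_edgeSet_le
    calc d * G.edgeSet.ncard ≤ d * (d * n) := Nat.mul_le_mul_left d h1
      _ = d * d * n := by ring
      _ < d * d * ((Nat.sqrt n + 1) * (Nat.sqrt n + 1)) :=
        Nat.mul_lt_mul_of_pos_left (Nat.lt_succ_sqrt n) (by positivity)
      _ = s * s := by rw [hs]; ring
  obtain ⟨k, hk⟩ := hG.exists_coloring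
  obtain ⟨f, hf, -, hstar, hcard⟩ := (hG.mono (Nat.le_succ b)).exists_strongStar hd1 hds hdm
  obtain ⟨p, hp, hdp, hp2⟩ := Nat.exists_prime_lt_and_le_two_mul d (by omega)
  obtain ⟨D, h1, h2, h3⟩ := exists_gridDrawing_of_coloring_of_strongStar hp hdp.le
    (fun v => k v) (fun v => (k v).2) (fun v w hvw h => hk v w hvw (Fin.ext h)) f hf hstar hcard
  have hsl : s * (n / s + 1) ≤ 3 * d * n := by
    have h4 := mul_div_add_one_le s n
    have h5 : 1 * n ≤ d * n := Nat.mul_le_mul_right n hd1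
    linarith
  set l := n / s + 1 with hl
  have hl1 : 1 ≤ l := Nat.succ_pos _
  have hs1 : 1 ≤ s := hd1.trans hds
  have hp1 : 1 ≤ p := hp.pos
  refine ⟨D, h1, h2.trans ?_, h3.trans ?_⟩
  · calc 3 * p * (11 * s) * d + 1 ≤ 3 * (2 * d) * (11 * s) * d + d ^ 2 * s :=
        add_le_add (by gcongr) (Nat.mul_pos (by positivity) hs1)
      _ = 67 * d ^ 3 * (Nat.sqrt n + 1) := by rw [hs]; ring
  · have h6 : 1 ≤ d * (p * l) := Nat.mul_pos hd1 (Nat.mul_pos hp1 hl1)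
    have h7 : 1 ≤ d ^ 3 * p * (11 * s) := by
      have : 0 < d ^ 3 * p * (11 * s) := by positivity
      exact this
    calc (6 * d * (p * l) + 1) * d * (3 * p * (11 * s) * d) + p * l
        ≤ (6 * d * (p * l) + d * (p * l)) * d * (3 * p * (11 * s) * d) +
          p * l * (d ^ 3 * p * (11 * s)) :=
        add_le_add (by gcongr) (Nat.le_mul_of_pos_right _ h7)
      -- `242 = 7 * 33 + 11`; then `p ≤ 2 * d` and `s * l ≤ 3 * d * n` give `2904 = 242 * 4 * 3`.
      _ = 242 * d ^ 3 * p ^ 2 * (s * l) := by ring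
      _ ≤ 242 * d ^ 3 * (2 * d) ^ 2 * (3 * d * n) := by gcongr
      _ = 2904 * d ^ 6 * n := by ring

end SimpleGraph

theorem mainTheorem3 :
    (∃ C : ℝ, ∀ (V : Type u) [Fintype V] [Nonempty V] (G : SimpleGraph V) (n m d : ℕ),
      n = Fintype.card V → m = G.edgeSet.ncard → d = G.degeneracy → 1 ≤ m →
      ∃ D : G.GridDrawing,
        (D.width : ℝ) ≤ C * Real.sqrt (d * m) ∧
        (D.depth : ℝ) ≤ C * Real.sqrt (d * m) ∧
        (D.height : ℝ) ≤ C * n ∧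
        (D.volume : ℝ) ≤ C * (d * n * m)) ∧
    (∀ b : ℕ, ∃ C : ℝ, ∀ (V : Type u) [Fintype V] [Nonempty V] (G : SimpleGraph V) (n : ℕ),
      n = Fintype.card V → G.degeneracy ≤ b →
      ∃ D : G.GridDrawing,
        (D.width : ℝ) ≤ C ∧
        (D.depth : ℝ) ≤ C * Real.sqrt n ∧
        (D.height : ℝ) ≤ C * n ∧
        (D.volume : ℝ) ≤ C * (n : ℝ) ^ (3 / 2 : ℝ)) := by
  constructor
  -- Each side costs a factor `44`: twice `22` for replacing `Nat.sqrt + 1` by the real root, and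
  -- `44` for the height. The cube covers the volume.
  · refine ⟨44 ^ 3, ?_⟩
    rintro V _ _ G n m d rfl rfl rfl hm
    obtain ⟨D, h1, h2, h3⟩ := G.exists_gridDrawing_of_one_le_ncard_edgeSet hm
    set d := G.degeneracy
    set m := G.edgeSet.ncard
    have hd : 1 ≤ d := SimpleGraph.one_le_degeneracy hm
    have hr := SimpleGraph.natCast_sqrt_add_one_le (Nat.mul_pos hd hm)
    rw [Nat.cast_mul] at hr
    set r := Real.sqrt (d * m) with hr'
    have hr0 : 0 ≤ r := Real.sqrt_nonneg _
    have hrr : r * r = d * m := Real.mul_self_sqrt (by positivity)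
    have h1' : (D.width : ℝ) ≤ 44 * r := by
      have : (D.width : ℝ) ≤ 22 * (Nat.sqrt (d * m) + 1 : ℕ) := by exact_mod_cast h1
      linarith
    have h2' : (D.depth : ℝ) ≤ 44 * r := by
      have : (D.depth : ℝ) ≤ 22 * (Nat.sqrt (d * m) + 1 : ℕ) := by exact_mod_cast h2
      linarith
    have h3' : (D.height : ℝ) ≤ 44 * Fintype.card V := by exact_mod_cast h3
    have hn0 : (0 : ℝ) ≤ Fintype.card V := by positivity
    refine ⟨D, by linarith, by linarith, by linarith, ?_⟩
    calc (D.volume : ℝ) = D.width * D.depth * D.height := by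
          simp [SimpleGraph.GridDrawing.volume]
      _ ≤ (44 * r) * (44 * r) * (44 * Fintype.card V) := by gcongr
      _ = 44 ^ 3 * (r * r * Fintype.card V) := by ring
      _ = 44 ^ 3 * (d * Fintype.card V * m) := by rw [hrr]; ring
  · intro b
    set A : ℝ := 2904 * (b + 1) ^ 6 with hA
    have hb1 : (1 : ℝ) ≤ b + 1 := by
      have : (0 : ℝ) ≤ b := by positivity
      linarith
    have hb6 : (1 : ℝ) ≤ (b + 1) ^ 6 := one_le_pow₀ hb1
    have hA1 : 1 ≤ A := by linarith
    have hA3 : A ≤ A ^ 3 := le_self_pow₀ hA1 (by norm_num)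
    refine ⟨A ^ 3, ?_⟩
    rintro V _ _ G n rfl hG
    obtain ⟨D, h1, h2, h3⟩ := (G.isDegenerate_degeneracy.mono hG).exists_gridDrawing
    have hr := SimpleGraph.natCast_sqrt_add_one_le (Fintype.card_pos : 0 < Fintype.card V)
    set n := Fintype.card V
    set r := Real.sqrt n with hr'
    have hr0 : 0 ≤ r := Real.sqrt_nonneg _
    have hn0 : (0 : ℝ) ≤ n := by positivity
    have h1' : (D.width : ℝ) ≤ A := by
      have h : (D.width : ℝ) ≤ b + 1 := by exact_mod_cast h1
      have : (b + 1 : ℝ) ≤ (b + 1) ^ 6 := le_self_pow₀ hb1 (by norm_num)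
      linarith
    have h2' : (D.depth : ℝ) ≤ A * r := by
      have h : (D.depth : ℝ) ≤ 67 * (b + 1) ^ 3 * (Nat.sqrt n + 1 : ℕ) := by exact_mod_cast h2
      have h' : (b + 1 : ℝ) ^ 3 ≤ (b + 1) ^ 6 := pow_le_pow_right₀ hb1 (by norm_num)
      calc (D.depth : ℝ) ≤ 67 * (b + 1) ^ 6 * (2 * r) := h.trans (by gcongr)
        _ = 134 * (b + 1) ^ 6 * r := by ring
        _ ≤ A * r := by
          rw [hA]
          gcongr
          norm_num
    have h3' : (D.height : ℝ) ≤ A * n := by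
      rw [hA]
      exact_mod_cast h3
    have hpow : (n : ℝ) ^ (3 / 2 : ℝ) = r * n := by
      rw [hr', Real.sqrt_eq_rpow, ← Real.rpow_add_one' hn0 (by norm_num)]
      norm_num
    refine ⟨D, h1'.trans hA3, h2'.trans (mul_le_mul_of_nonneg_right hA3 hr0),
      h3'.trans (mul_le_mul_of_nonneg_right hA3 hn0), ?_⟩
    calc (D.volume : ℝ) = D.width * D.depth * D.height := by
          simp [SimpleGraph.GridDrawing.volume]
      _ ≤ A * (A * r) * (A * n) := by gcongr
      _ = A ^ 3 * (n : ℝ) ^ (3 / 2 : ℝ) := by rw [hpow]; ring
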